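/- Let $H$ be a commutative ultrametric Banach ring containing $\mathbb{Q}$ (for example $H=\mathbb{Q}_p$ or any Banach $\mathbb{Q}_p$-algebra). Let $\mathrm{Ban}_H$ be the category of ultrametric Banach $H$-modules and bounded maps, with the completed projective tensor product, and let $\mathcal{C}$ be either the category $\mathrm{Ind}(\mathrm{Ban}_H)$ of ind-Banach modules or its full subcategory $\mathrm{Ind}^m(\mathrm{Ban}_H)$ of systems with monomorphic transition maps. Let $\mathrm{sComm}(\mathcal{C})$ be the category of simplicial commutative monoids in $\mathcal{C}$, with the homotopy theory in which $R\to S$ is a trivial fibration if $\mathrm{Hom}(P,R)\to\mathrm{Hom}(P,S)$ is a trivial Kan fibration for every projective $P$; the homotopy groups $\pi_n(R)$ lie in the left heart of $\mathcal{C}$, that is, they are the presheaves $P\mapsto\pi_n(\mathrm{Hom}(P,R))$ on projective modules. A morphism $A\to B$ in $\mathrm{sComm}(\mathcal{C})$, written $X=\mathrm{Spec}\,B\to Y=\mathrm{Spec}\,A$, is called *affinoid* if there are $d\ge 0$ and a surjection of $\pi_0(A)$-algebras $\pi_0(A)\langle X_1,\dots,X_d\rangle\to\pi_0(B)$ and if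 $\pi_0(B)\otimes_{\pi_0(A)}\pi_n(A)\to\pi_n(B)$ is an isomorphism for every $n$. Write $X(R)=\mathrm{Map}(B,R)$ and $Y(R)=\mathrm{Map}(A,R)$ for the derived mapping spaces. For $R$ in $\mathrm{sComm}(\mathcal{C})$ put $$Y_{X,\mathrm{dR}}(R)=\varinjlim_{I} X(\pi_0(R)/I)\times_{Y(\pi_0(R)/I)}Y(R),\qquad Y_{X,\mathrm{crys}}(R)=\varinjlim_{(I,\gamma)} X(\pi_0(R)/I)\times_{Y(\pi_0(R)/I)}Y(R),$$ where $I$ runs over the nilpotent ideals of $\pi_0(R)$, ordered by inclusion, and $(I,\gamma)$ runs over the nilpotent ideals $I$ of $\pi_0(R)$ together with a divided power structure $\gamma$ on the ideal of global elements of $I$ in the underlying ring of $\pi_0(R)$, with a transition map $(I,\gamma)\to(I',\gamma')$ if $I\subseteq I'$ and $\gamma'$ extends $\gamma$. An affinoid morphism $X\to Y$ is called *de Rham intrinsic lisse* if $\pi_0(X(R))\to\pi_0(Y_{X,\mathrm{dR}}(R))$ is surjective for every $R$ in $\mathrm{sComm}(\mathcal{C})$, and *PD intrinsic lisse* if $\pi_0(X(R))\to\pi_0(Y_{X,\mathrm{crys}}(R))$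 is surjective for every $R$ in $\mathrm{sComm}(\mathcal{C})$. Then every de Rham intrinsic lisse morphism is a PD intrinsic lisse morphism. -/

import Mathlib

open CategoryTheory Opposite TensorProduct

universe u

noncomputable section

/-! ### Normed modules over an ultrametric Banach ring -/

/-- An ultrametric seminormed module over the normed ring `H`. -/
structure NMod (H : Type u) [NormedCommRing H] : Type (u + 1) where
  carrier : Type u
  [grp : SeminormedAddCommGroup carrier]
  [mod : Module H carrier]
  norm_smul_le : ∀ (h : H) (x : carrier), ‖h • x‖ ≤ ‖h‖ * ‖x‖
  norm_add_le_max : ∀ x y : carrier, ‖x + y‖ ≤ max ‖x‖ ‖y‖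

namespace NMod

variable {H : Type u} [NormedCommRing H]

instance : CoeSort (NMod H) (Type u) := ⟨NMod.carrier⟩
instance (P : NMod H) : SeminormedAddCommGroup P := P.grp
instance (P : NMod H) : Module H P := P.mod

/-- A Banach module: complete and separated. -/
def IsBanach (P : NMod H) : Prop :=
  CompleteSpace P ∧ ∀ x : P, ‖x‖ = 0 → x = 0

/-- A bounded `H`-linear map. -/
@[ext]
structure BMap (P Q : NMod H) where
  lin : P →ₗ[H] Q
  bdd : ∃ C : ℝ, 0 ≤ C ∧ ∀ x, ‖lin x‖ ≤ C * ‖x‖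

instance : Category (NMod H) where
  Hom P Q := BMap P Q
  id P := ⟨LinearMap.id, 1, zero_le_one, fun x => by simp⟩
  comp f g := ⟨g.lin ∘ₗ f.lin, by
    obtain ⟨C, hC, h⟩ := f.bdd
    obtain ⟨D, hD, h'⟩ := g.bdd
    refine ⟨D * C, mul_nonneg hD hC, fun x => ?_⟩
    calc ‖g.lin (f.lin x)‖ ≤ D * ‖f.lin x‖ := h' _
      _ ≤ D * (C * ‖x‖) := mul_le_mul_of_nonneg_left (h x) hD
      _ = D * C * ‖x‖ := by ring⟩

/-- The underlying linear map of a morphism. -/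
def lin {P Q : NMod H} (f : P ⟶ Q) : P →ₗ[H] Q := BMap.lin f

/-- Constructor for morphisms. -/
def ofLin {P Q : NMod H} (f : P →ₗ[H] Q) (C : ℝ) (hC : 0 ≤ C)
    (h : ∀ x, ‖f x‖ ≤ C * ‖x‖) : P ⟶ Q :=
  (⟨f, C, hC, h⟩ : BMap P Q)

@[simp] theorem lin_ofLin {P Q : NMod H} (f : P →ₗ[H] Q) (C : ℝ) (hC : 0 ≤ C)
    (h : ∀ x, ‖f x‖ ≤ C * ‖x‖) : lin (ofLin f C hC h) = f := rfl

@[simp] theorem lin_id (P : NMod H) : lin (𝟙 P) = LinearMap.id := rfl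

@[simp] theorem lin_comp {P Q R : NMod H} (f : P ⟶ Q) (g : Q ⟶ R) :
    lin (f ≫ g) = lin g ∘ₗ lin f := rfl

theorem hom_ext {P Q : NMod H} {f g : P ⟶ Q} (h : lin f = lin g) : f = g :=
  BMap.ext h

theorem lin_bdd {P Q : NMod H} (f : P ⟶ Q) :
    ∃ C : ℝ, 0 ≤ C ∧ ∀ x, ‖lin f x‖ ≤ C * ‖x‖ := BMap.bdd f

/-- `i : P ⟶ Q` is an isometry with dense image, so that `P` and `Q` have the same completion. -/
def IsDense {P Q : NMod H} (i : P ⟶ Q) : Prop :=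
  (∀ x, ‖lin i x‖ = ‖x‖) ∧ DenseRange (lin i)

/-- A strict epimorphism: a surjection whose target carries the quotient norm up to equivalence. -/
def IsStrictEpi {P Q : NMod H} (q : P ⟶ Q) : Prop :=
  ∃ C : ℝ, ∀ y : Q, ∃ x : P, lin q x = y ∧ ‖x‖ ≤ C * ‖y‖

/-- `P` is projective: bounded maps from `P` lift along strict epimorphisms of Banach modules. -/
def IsProjective (P : NMod H) : Prop :=
  ∀ (M N : NMod H), M.IsBanach → N.IsBanach → ∀ q : M ⟶ N, IsStrictEpi q →
    ∀ f : P ⟶ N, ∃ g : P ⟶ M, g ≫ q = f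

/-! ### The projective tensor product -/

section Tensor

variable (P Q : NMod H)

/-- The additive subgroup of `P ⊗ Q` generated by the tensors `p ⊗ q` with `‖p‖ * ‖q‖ ≤ r`. -/
def tLevel (r : ℝ) : AddSubgroup (P ⊗[H] Q) :=
  AddSubgroup.closure {z | ∃ (p : P) (q : Q), ‖p‖ * ‖q‖ ≤ r ∧ p ⊗ₜ[H] q = z}

/-- The ultrametric projective seminorm: the infimum over all presentations `z = ∑ pᵢ ⊗ qᵢ`
of `max ‖pᵢ‖ * ‖qᵢ‖`. -/
def tNorm (z : P ⊗[H] Q) : ℝ := sInf {r : ℝ | 0 ≤ r ∧ z ∈ tLevel P Q r}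

variable {P Q}

theorem tLevel_mono {r s : ℝ} (h : r ≤ s) : tLevel P Q r ≤ tLevel P Q s :=
  AddSubgroup.closure_mono (by
    rintro z ⟨p, q, hpq, rfl⟩
    exact ⟨p, q, hpq.trans h, rfl⟩)

theorem tNorm_nonempty (z : P ⊗[H] Q) : {r : ℝ | 0 ≤ r ∧ z ∈ tLevel P Q r}.Nonempty := by
  induction z using TensorProduct.induction_on with
  | zero => exact ⟨0, le_rfl, zero_mem _⟩
  | tmul p q =>
    exact ⟨‖p‖ * ‖q‖, by positivity, AddSubgroup.subset_closure ⟨p, q, le_rfl, rfl⟩⟩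
  | add x y hx hy =>
    obtain ⟨r, hr, hx⟩ := hx
    obtain ⟨s, hs, hy⟩ := hy
    exact ⟨max r s, le_max_of_le_left hr,
      add_mem (tLevel_mono (le_max_left r s) hx) (tLevel_mono (le_max_right r s) hy)⟩

theorem tNorm_bddBelow (z : P ⊗[H] Q) : BddBelow {r : ℝ | 0 ≤ r ∧ z ∈ tLevel P Q r} :=
  ⟨0, fun _ h => h.1⟩

theorem tNorm_nonneg (z : P ⊗[H] Q) : 0 ≤ tNorm P Q z :=
  Real.sInf_nonneg fun _ h => h.1

theorem tNorm_le {z : P ⊗[H] Q} {r : ℝ} (hr : 0 ≤ r) (h : z ∈ tLevel P Q r) :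
    tNorm P Q z ≤ r := csInf_le (tNorm_bddBelow z) ⟨hr, h⟩

theorem mem_tLevel_of_lt {z : P ⊗[H] Q} {r : ℝ} (h : tNorm P Q z < r) : z ∈ tLevel P Q r := by
  obtain ⟨s, hs, hsr⟩ := exists_lt_of_csInf_lt (tNorm_nonempty z) h
  exact tLevel_mono hsr.le hs.2

theorem tNorm_zero : tNorm P Q 0 = 0 :=
  le_antisymm (tNorm_le le_rfl (zero_mem _)) (tNorm_nonneg _)

theorem tNorm_neg (z : P ⊗[H] Q) : tNorm P Q (-z) = tNorm P Q z := by
  simp only [tNorm, neg_mem_iff]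

theorem tNorm_add_le_max (z w : P ⊗[H] Q) :
    tNorm P Q (z + w) ≤ max (tNorm P Q z) (tNorm P Q w) := by
  refine le_of_forall_gt fun r hr => ?_
  obtain ⟨s, hs, hsr⟩ := exists_between hr
  have h0 : 0 ≤ s := ((tNorm_nonneg z).trans (le_max_left _ _)).trans hs.le
  exact (tNorm_le h0 (add_mem (mem_tLevel_of_lt ((le_max_left _ _).trans_lt hs))
    (mem_tLevel_of_lt ((le_max_right _ _).trans_lt hs)))).trans_lt hsr

theorem tNorm_smul_le (h : H) (z : P ⊗[H] Q) : tNorm P Q (h • z) ≤ ‖h‖ * tNorm P Q z := by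
  have key : ∀ r : ℝ, z ∈ tLevel P Q r → h • z ∈ tLevel P Q (‖h‖ * r) := by
    intro r hz
    induction hz using AddSubgroup.closure_induction with
    | mem x hx =>
      obtain ⟨p, q, hpq, rfl⟩ := hx
      refine AddSubgroup.subset_closure ⟨h • p, q, ?_, TensorProduct.smul_tmul' _ _ _⟩
      calc ‖h • p‖ * ‖q‖ ≤ (‖h‖ * ‖p‖) * ‖q‖ :=
            mul_le_mul_of_nonneg_right (P.norm_smul_le h p) (norm_nonneg _)
        _ = ‖h‖ * (‖p‖ * ‖q‖) := by ring
        _ ≤ ‖h‖ * r := mul_le_mul_of_nonneg_left hpq (norm_nonneg _)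
    | zero => simp
    | add x y _ _ hx hy => rw [smul_add]; exact add_mem hx hy
    | neg x _ hx => rw [smul_neg]; exact neg_mem hx
  have h2 : ∀ r : ℝ, tNorm P Q z < r → tNorm P Q (h • z) ≤ ‖h‖ * r := fun r hr =>
    tNorm_le (mul_nonneg (norm_nonneg _) ((tNorm_nonneg z).trans hr.le))
      (key r (mem_tLevel_of_lt hr))
  have hc : Filter.Tendsto (fun r : ℝ => ‖h‖ * r) (nhdsWithin (tNorm P Q z) (Set.Ioi (tNorm P Q z)))
      (nhds (‖h‖ * tNorm P Q z)) :=
    ((continuous_const.mul continuous_id).tendsto _).mono_left nhdsWithin_le_nhds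
  exact ge_of_tendsto hc (eventually_nhdsWithin_of_forall fun r hr => h2 r hr)

variable (P Q)

/-- The tensor product of two seminormed modules. -/
def tens : NMod H where
  carrier := P ⊗[H] Q
  grp := (({ toFun := tNorm P Q
             map_zero' := tNorm_zero
             add_le' := fun x y => (tNorm_add_le_max x y).trans
               (max_le_add_of_nonneg (tNorm_nonneg x) (tNorm_nonneg y))
             neg' := tNorm_neg } : AddGroupSeminorm (P ⊗[H] Q))).toSeminormedAddCommGroup
  mod := inferInstanceAs (Module H (P ⊗[H] Q))
  norm_smul_le := tNorm_smul_le
  norm_add_le_max := tNorm_add_le_max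

variable {P Q}

theorem norm_tens (z : tens P Q) : ‖z‖ = tNorm P Q z := rfl

/-- The universal property of the projective seminorm. -/
theorem norm_le_of_tmul {N : NMod H} (g : P ⊗[H] Q →ₗ[H] N) (C : ℝ) (hC : 0 ≤ C)
    (h : ∀ p q, ‖g (p ⊗ₜ q)‖ ≤ C * (‖p‖ * ‖q‖)) (z : P ⊗[H] Q) :
    ‖g z‖ ≤ C * tNorm P Q z := by
  have key : ∀ r : ℝ, 0 ≤ r → z ∈ tLevel P Q r → ‖g z‖ ≤ C * r := by
    intro r hr hz
    induction hz using AddSubgroup.closure_induction with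
    | mem x hx =>
      obtain ⟨p, q, hpq, rfl⟩ := hx
      exact (h p q).trans (mul_le_mul_of_nonneg_left hpq hC)
    | zero => simpa using mul_nonneg hC hr
    | add x y _ _ hx hy =>
      rw [map_add]; exact (N.norm_add_le_max _ _).trans (max_le hx hy)
    | neg x _ hx => rw [map_neg, norm_neg]; exact hx
  have hc : Filter.Tendsto (fun r : ℝ => C * r) (nhdsWithin (tNorm P Q z) (Set.Ioi (tNorm P Q z)))
      (nhds (C * tNorm P Q z)) :=
    ((continuous_const.mul continuous_id).tendsto _).mono_left nhdsWithin_le_nhds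
  exact ge_of_tendsto hc (eventually_nhdsWithin_of_forall fun r hr =>
    key r ((tNorm_nonneg z).trans (le_of_lt hr)) (mem_tLevel_of_lt hr))

theorem tNorm_tmul_le (p : P) (q : Q) : tNorm P Q (p ⊗ₜ q) ≤ ‖p‖ * ‖q‖ :=
  tNorm_le (by positivity) (AddSubgroup.subset_closure ⟨p, q, le_rfl, rfl⟩)

/-- The morphism out of a tensor product given by a bounded bilinear map. -/
def tLift {N : NMod H} (g : P ⊗[H] Q →ₗ[H] N) (C : ℝ) (hC : 0 ≤ C)
    (h : ∀ p q, ‖g (p ⊗ₜ q)‖ ≤ C * (‖p‖ * ‖q‖)) : tens P Q ⟶ N :=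
  ofLin (P := tens P Q) g C hC (norm_le_of_tmul g C hC h)

/-- The tensor product of two morphisms. -/
def tMap {P' Q' : NMod H} (f : P ⟶ P') (g : Q ⟶ Q') : tens P Q ⟶ tens P' Q' :=
  (⟨TensorProduct.map (lin f) (lin g), by
    obtain ⟨C, hC, hf⟩ := lin_bdd f
    obtain ⟨D, hD, hg⟩ := lin_bdd g
    refine ⟨C * D, mul_nonneg hC hD, norm_le_of_tmul (N := tens P' Q')
      (TensorProduct.map (lin f) (lin g)) (C * D) (mul_nonneg hC hD) fun p q => ?_⟩
    calc tNorm P' Q' (lin f p ⊗ₜ lin g q) ≤ ‖lin f p‖ * ‖lin g q‖ := tNorm_tmul_le _ _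
      _ ≤ (C * ‖p‖) * (D * ‖q‖) :=
        mul_le_mul (hf p) (hg q) (norm_nonneg _) (mul_nonneg hC (norm_nonneg _))
      _ = C * D * (‖p‖ * ‖q‖) := by ring⟩ : BMap _ _)

variable (P Q)

/-- The symmetry of the tensor product. -/
def tSwap : tens P Q ⟶ tens Q P :=
  tLift (N := tens Q P) (TensorProduct.comm H P Q).toLinearMap 1 zero_le_one fun p q => by
    rw [one_mul, mul_comm]
    exact tNorm_tmul_le q p

/-- The associativity of the tensor product. -/
def tAssoc (S : NMod H) : tens (tens P Q) S ⟶ tens P (tens Q S) :=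
  tLift (P := tens P Q) (N := tens P (tens Q S))
    (TensorProduct.assoc H P Q S).toLinearMap 1 zero_le_one fun w s => by
      have := norm_le_of_tmul (N := tens P (tens Q S))
        ((TensorProduct.assoc H P Q S).toLinearMap ∘ₗ (TensorProduct.mk H (P ⊗[H] Q) S).flip s)
        ‖s‖ (norm_nonneg s) (fun p q => by
          refine (tNorm_tmul_le (Q := tens Q S) p (q ⊗ₜ s : Q ⊗[H] S)).trans ?_
          calc ‖p‖ * tNorm Q S (q ⊗ₜ s) ≤ ‖p‖ * (‖q‖ * ‖s‖) :=
                mul_le_mul_of_nonneg_left (tNorm_tmul_le q s) (norm_nonneg p)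
            _ = ‖s‖ * (‖p‖ * ‖q‖) := by ring) w
      rw [one_mul, mul_comm]
      exact this

end Tensor

variable [IsUltrametricDist H]

variable (H) in
/-- The unit object: `H` as a module over itself. -/
def unit : NMod H where
  carrier := H
  grp := inferInstance
  mod := inferInstance
  norm_smul_le := fun h x => norm_mul_le h x
  norm_add_le_max := fun x y => IsUltrametricDist.norm_add_le_max x y

/-- The unit constraint `p ↦ 1 ⊗ p`. -/
def tUnit (P : NMod H) : P ⟶ tens (unit H) P :=
  ofLin (Q := tens (unit H) P) (TensorProduct.mk H H P 1) ‖(1 : H)‖ (norm_nonneg _)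
    (fun p => tNorm_tmul_le (P := unit H) (1 : H) p)

end NMod

open NMod

/-! ### Linear presheaves and commutative algebras -/

/-- An `H`-linear presheaf on seminormed modules which only depends on completions, that is, an
`H`-linear presheaf on the category of Banach modules.  A small filtered diagram `X` of Banach
modules is identified with the presheaf `P ↦ colim_j Hom(P, X_j)`; the objects of the left heart
are the linear presheaves, considered on projective modules. -/
structure LinPsh (H : Type u) [NormedCommRing H] where
  obj : NMod H → Type u
  [grp : ∀ P, AddCommGroup (obj P)]
  [mod : ∀ P, Module H (obj P)]
  map : ∀ {P Q : NMod H}, (P ⟶ Q) → (obj Q →ₗ[H] obj P)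
  map_id : ∀ (P : NMod H) (x : obj P), map (𝟙 P) x = x
  map_comp : ∀ {P Q S : NMod H} (f : P ⟶ Q) (g : Q ⟶ S) (x : obj S),
    map (f ≫ g) x = map f (map g x)
  map_add : ∀ {P Q : NMod H} (f g h : P ⟶ Q), lin h = lin f + lin g →
    ∀ x : obj Q, map h x = map f x + map g x
  map_smul : ∀ {P Q : NMod H} (a : H) (f h : P ⟶ Q), lin h = a • lin f →
    ∀ x : obj Q, map h x = a • map f x
  bijective_of_isDense : ∀ {P Q : NMod H} (i : P ⟶ Q), IsDense i → Function.Bijective (map i)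

instance {H : Type u} [NormedCommRing H] (F : LinPsh H) (P : NMod H) :
    AddCommGroup (F.obj P) := F.grp P

instance {H : Type u} [NormedCommRing H] (F : LinPsh H) (P : NMod H) :
    Module H (F.obj P) := F.mod P

/-- The two kinds of inductive systems: all small filtered ones, and those with monomorphic
transition maps. -/
inductive IndKind
  | all
  | mono

/-- `F` is (represented by) an ind-Banach module: it is the filtered colimit of the presheaves
represented by a small filtered diagram `X` of Banach modules, the colimit cocone being given by
the elements `ξ j ∈ F (X j)`. -/
def LinPsh.IsIndBanach {H : Type u} [NormedCommRing H] (k : IndKind) (F : LinPsh H) : Prop :=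
  ∃ (J : Type u) (_ : SmallCategory J) (_ : IsFiltered J) (X : J ⥤ NMod H)
    (ξ : ∀ j, F.obj (X.obj j)),
    (∀ j, (X.obj j).IsBanach) ∧
    (k = IndKind.mono → ∀ (i j : J) (t : i ⟶ j), Function.Injective (lin (X.map t))) ∧
    (∀ (i j : J) (t : i ⟶ j), F.map (X.map t) (ξ j) = ξ i) ∧
    (∀ (P : NMod H) (x : F.obj P), ∃ (j : J) (f : P ⟶ X.obj j), F.map f (ξ j) = x) ∧
    (∀ (P : NMod H) (i : J) (f g : P ⟶ X.obj i), F.map f (ξ i) = F.map g (ξ i) →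
      ∃ (j : J) (t : i ⟶ j), f ≫ X.map t = g ≫ X.map t)

/-- A commutative algebra: a linear presheaf with a lax symmetric monoidal structure, that is, a
commutative monoid for the Day convolution of the completed tensor product. -/
structure CAlg (H : Type u) [NormedCommRing H] [IsUltrametricDist H] extends LinPsh H where
  mul : ∀ {P Q : NMod H}, obj P →ₗ[H] obj Q →ₗ[H] obj (tens P Q)
  one : obj (unit H)
  mul_natural : ∀ {P P' Q Q' : NMod H} (f : P ⟶ P') (g : Q ⟶ Q') (x : obj P') (y : obj Q'),
    map (tMap f g) (mul x y) = mul (map f x) (map g y)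
  mul_comm' : ∀ {P Q : NMod H} (x : obj P) (y : obj Q), map (tSwap P Q) (mul y x) = mul x y
  mul_assoc' : ∀ {P Q S : NMod H} (x : obj P) (y : obj Q) (z : obj S),
    map (tAssoc P Q S) (mul x (mul y z)) = mul (mul x y) z
  one_mul' : ∀ {P : NMod H} (x : obj P), map (tUnit P) (mul one x) = x

namespace CAlg

variable {H : Type u} [NormedCommRing H] [IsUltrametricDist H]

/-- A homomorphism of commutative algebras. -/
@[ext]
structure Hom (F G : CAlg H) where
  app : ∀ P : NMod H, F.obj P →ₗ[H] G.obj P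
  natural : ∀ {P Q : NMod H} (f : P ⟶ Q) (x : F.obj Q), app P (F.map f x) = G.map f (app Q x)
  app_mul : ∀ {P Q : NMod H} (x : F.obj P) (y : F.obj Q),
    app (tens P Q) (F.mul x y) = G.mul (app P x) (app Q y)
  app_one : app (unit H) F.one = G.one

instance : Category (CAlg H) where
  Hom F G := Hom F G
  id F := ⟨fun _ => LinearMap.id, fun _ _ => rfl, fun _ _ => rfl, rfl⟩
  comp a b := ⟨fun P => b.app P ∘ₗ a.app P,
    fun f x => by simp [a.natural, b.natural],
    fun x y => by simp [a.app_mul, b.app_mul],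
    by simp [a.app_one, b.app_one]⟩

/-- The components of a homomorphism. -/
def app {F G : CAlg H} (a : F ⟶ G) (P : NMod H) : F.obj P →ₗ[H] G.obj P := Hom.app a P

theorem app_natural {F G : CAlg H} (a : F ⟶ G) {P Q : NMod H} (f : P ⟶ Q) (x : F.obj Q) :
    app a P (F.map f x) = G.map f (app a Q x) := Hom.natural a f x

theorem app_mul {F G : CAlg H} (a : F ⟶ G) {P Q : NMod H} (x : F.obj P) (y : F.obj Q) :
    app a (tens P Q) (F.mul x y) = G.mul (app a P x) (app a Q y) := Hom.app_mul a x y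

theorem app_one {F G : CAlg H} (a : F ⟶ G) : app a (unit H) F.one = G.one := Hom.app_one a

theorem hom_ext {F G : CAlg H} {a b : F ⟶ G} (h : ∀ P x, app a P x = app b P x) : a = b :=
  Hom.ext (funext fun P => LinearMap.ext fun x => h P x)

@[simp] theorem app_id (F : CAlg H) (P : NMod H) (x : F.obj P) : app (𝟙 F) P x = x := rfl

@[simp] theorem app_comp {F G K : CAlg H} (a : F ⟶ G) (b : G ⟶ K) (P : NMod H) (x : F.obj P) :
    app (a ≫ b) P x = app b P (app a P x) := rfl

/-- Evaluation at a module `P`, i.e. the set of maps from `P` to the underlying module. -/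
def evalAt (P : NMod H) : CAlg H ⥤ Type u where
  obj F := F.obj P
  map a := ↾fun x => app a P x

theorem swap_one {A : Type u} [CommRing A] (h : A) : h ⊗ₜ[A] (1 : A) = (1 : A) ⊗ₜ[A] h := by
  have h1 := TensorProduct.smul_tmul (R := A) h (1 : A) (1 : A)
  rwa [smul_eq_mul, mul_one] at h1

/-- The product of two global elements. -/
def ptMul (F : CAlg H) (x y : F.obj (unit H)) : F.obj (unit H) :=
  F.map (tUnit (unit H)) (F.mul x y)

theorem ptMul_comm (F : CAlg H) (x y : F.obj (unit H)) : F.ptMul x y = F.ptMul y x := by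
  have h : tUnit (unit H) ≫ tSwap (unit H) (unit H) = tUnit (unit H) := by
    refine NMod.hom_ext (LinearMap.ext fun h => ?_)
    exact swap_one (A := H) h
  rw [ptMul, ptMul, ← F.mul_comm' x y, ← F.map_comp, h]

theorem ptMul_assoc (F : CAlg H) (x y z : F.obj (unit H)) :
    F.ptMul (F.ptMul x y) z = F.ptMul x (F.ptMul y z) := by
  have h1 := F.mul_natural (tUnit (unit H)) (𝟙 (unit H)) (F.mul x y) z
  have h2 := F.mul_natural (𝟙 (unit H)) (tUnit (unit H)) x (F.mul y z)
  rw [F.map_id] at h1 h2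
  have h3 : tUnit (unit H) ≫ tMap (tUnit (unit H)) (𝟙 (unit H)) ≫
      tAssoc (unit H) (unit H) (unit H) =
      tUnit (unit H) ≫ tMap (𝟙 (unit H)) (tUnit (unit H)) :=
    NMod.hom_ext (LinearMap.ext fun h => rfl)
  simp only [ptMul]
  rw [← h1, ← h2, ← F.mul_assoc', ← F.map_comp, ← F.map_comp, ← F.map_comp, ← h3]
  rfl

theorem ptMul_add (F : CAlg H) (x y z : F.obj (unit H)) :
    F.ptMul x (y + z) = F.ptMul x y + F.ptMul x z := by simp [ptMul]

theorem add_ptMul (F : CAlg H) (x y z : F.obj (unit H)) :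
    F.ptMul (x + y) z = F.ptMul x z + F.ptMul y z := by simp [ptMul]

theorem ptMul_zero (F : CAlg H) (x : F.obj (unit H)) : F.ptMul x 0 = 0 := by simp [ptMul]

theorem one_ptMul (F : CAlg H) (x : F.obj (unit H)) : F.ptMul F.one x = x := F.one_mul' x

/-- The underlying commutative ring of a commutative algebra: its set of global elements, that is,
of maps from the unit object. -/
def Pts (F : CAlg H) : Type u := F.obj (unit H)

instance (F : CAlg H) : AddCommGroup F.Pts := inferInstanceAs (AddCommGroup (F.obj (unit H)))

instance (F : CAlg H) : CommRing F.Pts :=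
  { (inferInstance : AddCommGroup F.Pts) with
    mul := F.ptMul
    one := F.one
    left_distrib := F.ptMul_add
    right_distrib := F.add_ptMul
    zero_mul := fun x => (F.ptMul_comm _ _).trans (F.ptMul_zero x)
    mul_zero := F.ptMul_zero
    mul_comm := F.ptMul_comm
    mul_assoc := F.ptMul_assoc
    one_mul := F.one_ptMul
    mul_one := fun x => (F.ptMul_comm _ _).trans (F.one_ptMul x) }

/-! ### Ideals and quotients -/

/-- An ideal of a commutative algebra: a subpresheaf (depending only on completions) which is
stable under multiplication. -/
@[ext]
structure Idl (F : CAlg H) where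
  sub : ∀ P : NMod H, Submodule H (F.obj P)
  map_mem : ∀ {P Q : NMod H} (f : P ⟶ Q) {x : F.obj Q}, x ∈ sub Q → F.map f x ∈ sub P
  mul_mem : ∀ {P Q : NMod H} (x : F.obj P) {y : F.obj Q}, y ∈ sub Q → F.mul x y ∈ sub (tens P Q)
  mem_of_isDense : ∀ {P Q : NMod H} (i : P ⟶ Q), IsDense i →
    ∀ {x : F.obj Q}, F.map i x ∈ sub P → x ∈ sub Q

namespace Idl

variable {F : CAlg H}

theorem mul_mem' (J : Idl F) {P Q : NMod H} {x : F.obj P} (y : F.obj Q) (hx : x ∈ J.sub P) :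
    F.mul x y ∈ J.sub (tens P Q) := by
  rw [← F.mul_comm' x y]
  exact J.map_mem _ (J.mul_mem y hx)

instance : PartialOrder (Idl F) :=
  PartialOrder.lift (fun J => J.sub) (fun _ _ h => Idl.ext h)

/-- The ideal of the underlying ring consisting of the global elements of `J`. -/
def pts (J : Idl F) : Ideal F.Pts where
  carrier := {x | (show F.obj (unit H) from x) ∈ J.sub (unit H)}
  add_mem' := fun ha hb => (J.sub (unit H)).add_mem ha hb
  zero_mem' := (J.sub (unit H)).zero_mem
  smul_mem' := fun c _ hx => J.map_mem _ (J.mul_mem (show F.obj (unit H) from c) hx)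

/-- `J.IsProd n P x`: the element `x ∈ F P` is a product of `n` elements of `J`. -/
inductive IsProd (J : Idl F) : ℕ → ∀ P : NMod H, F.obj P → Prop
  | zero : IsProd J 0 (unit H) F.one
  | succ {n : ℕ} {P Q : NMod H} {x : F.obj P} {y : F.obj Q} :
      IsProd J n P x → y ∈ J.sub Q → IsProd J (n + 1) (tens P Q) (F.mul x y)

/-- `J` is nilpotent: `J ^ n = 0` for some `n`. -/
def IsNilp (J : Idl F) : Prop :=
  ∃ n : ℕ, ∀ (P : NMod H) (x : F.obj P), J.IsProd n P x → x = 0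

/-- The zero ideal. -/
def zero (F : CAlg H) : Idl F where
  sub _ := ⊥
  map_mem f x hx := by
    rw [Submodule.mem_bot] at hx ⊢
    rw [hx, map_zero]
  mul_mem x y hy := by
    rw [Submodule.mem_bot] at hy ⊢
    rw [hy, map_zero]
  mem_of_isDense i hi x hx := by
    rw [Submodule.mem_bot] at hx ⊢
    exact (F.bijective_of_isDense i hi).1 (hx.trans (map_zero _).symm)

theorem zero_isNilp (F : CAlg H) : (zero F).IsNilp := by
  refine ⟨1, fun P x hx => ?_⟩
  cases hx with
  | succ _ hy => rw [(Submodule.mem_bot H).1 hy, map_zero]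

theorem pts_zero (F : CAlg H) : (zero F).pts = ⊥ := rfl

/-- The multiplication of the quotient by an ideal. -/
def quotMul (J : Idl F) {P Q : NMod H} :
    (F.obj P ⧸ J.sub P) →ₗ[H] (F.obj Q ⧸ J.sub Q) →ₗ[H] (F.obj (tens P Q) ⧸ J.sub (tens P Q)) :=
  Submodule.liftQ _
    (LinearMap.mk₂ H (fun x y => Submodule.mapQ (J.sub Q) (J.sub (tens P Q)) (F.mul x)
        (fun _ hy => J.mul_mem x hy) y)
      (fun x x' y => by
        obtain ⟨y, rfl⟩ := Submodule.mkQ_surjective _ y; simp)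
      (fun a x y => by
        obtain ⟨y, rfl⟩ := Submodule.mkQ_surjective _ y; simp)
      (fun x y y' => map_add _ _ _) (fun a x y => map_smul _ _ _))
    (fun x hx => by
      refine LinearMap.ext fun y => ?_
      obtain ⟨y, rfl⟩ := Submodule.mkQ_surjective _ y
      simpa using J.mul_mem' y hx)

theorem quotMul_mk (J : Idl F) {P Q : NMod H} (x : F.obj P) (y : F.obj Q) :
    J.quotMul (Submodule.Quotient.mk x) (Submodule.Quotient.mk y) =
      Submodule.Quotient.mk (F.mul x y) := rfl

/-- The quotient of a commutative algebra by an ideal (in the left heart). -/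
def quot (J : Idl F) : CAlg H where
  obj P := F.obj P ⧸ J.sub P
  map f := Submodule.mapQ _ _ (F.map f) (fun _ hx => J.map_mem f hx)
  map_id P x := by
    obtain ⟨x, rfl⟩ := Submodule.mkQ_surjective _ x
    simp [F.map_id]
  map_comp f g x := by
    obtain ⟨x, rfl⟩ := Submodule.mkQ_surjective _ x
    simp [F.map_comp]
  map_add f g h hh x := by
    obtain ⟨x, rfl⟩ := Submodule.mkQ_surjective _ x
    simp [F.map_add f g h hh]
  map_smul a f h hh x := by
    obtain ⟨x, rfl⟩ := Submodule.mkQ_surjective _ x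
    simp [F.map_smul a f h hh]
  bijective_of_isDense {P Q} i hi := by
    constructor
    · refine (injective_iff_map_eq_zero _).2 fun x hx => ?_
      obtain ⟨x, rfl⟩ := Submodule.mkQ_surjective _ x
      simp only [Submodule.mkQ_apply, Submodule.mapQ_apply, Submodule.Quotient.mk_eq_zero] at hx ⊢
      exact J.mem_of_isDense i hi hx
    · intro x
      obtain ⟨x, rfl⟩ := Submodule.mkQ_surjective _ x
      obtain ⟨y, rfl⟩ := (F.bijective_of_isDense i hi).2 x
      exact ⟨Submodule.Quotient.mk y, by simp⟩
  mul := J.quotMul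
  one := Submodule.Quotient.mk F.one
  mul_natural f g x y := by
    obtain ⟨x, rfl⟩ := Submodule.mkQ_surjective _ x
    obtain ⟨y, rfl⟩ := Submodule.mkQ_surjective _ y
    simp [quotMul_mk, F.mul_natural]
  mul_comm' x y := by
    obtain ⟨x, rfl⟩ := Submodule.mkQ_surjective _ x
    obtain ⟨y, rfl⟩ := Submodule.mkQ_surjective _ y
    simp [quotMul_mk, F.mul_comm']
  mul_assoc' x y z := by
    obtain ⟨x, rfl⟩ := Submodule.mkQ_surjective _ x
    obtain ⟨y, rfl⟩ := Submodule.mkQ_surjective _ y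
    obtain ⟨z, rfl⟩ := Submodule.mkQ_surjective _ z
    simp [quotMul_mk, F.mul_assoc']
  one_mul' x := by
    obtain ⟨x, rfl⟩ := Submodule.mkQ_surjective _ x
    simp [quotMul_mk, F.one_mul']

/-- The quotient map. -/
def proj (J : Idl F) : F ⟶ J.quot :=
  (⟨fun P => (J.sub P).mkQ, fun _ _ => rfl, fun _ _ => rfl, rfl⟩ : Hom F J.quot)

/-- The transition map between quotients. -/
def trans {J K : Idl F} (h : J ≤ K) : J.quot ⟶ K.quot :=
  (⟨fun P => Submodule.mapQ _ _ LinearMap.id (fun _ hx => h P hx),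
    fun f x => by obtain ⟨x, rfl⟩ := Submodule.mkQ_surjective _ x; rfl,
    fun x y => by
      obtain ⟨x, rfl⟩ := Submodule.mkQ_surjective _ x
      obtain ⟨y, rfl⟩ := Submodule.mkQ_surjective _ y
      rfl,
    rfl⟩ : Hom J.quot K.quot)

end Idl

end CAlg

namespace CAlg

variable {H : Type u} [NormedCommRing H] [IsUltrametricDist H]

/-! ### Simplicial commutative algebras -/

/-- The `n`-th term of a simplicial algebra. -/
abbrev term (R : SimplicialObject (CAlg H)) (n : ℕ) : CAlg H := R.obj (op (SimplexCategory.mk n))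

/-- `R` is a simplicial commutative ind-Banach algebra over `H`, with inductive systems of the
given kind. -/
def IsSimplicialIndBanach (k : IndKind) (R : SimplicialObject (CAlg H)) : Prop :=
  ∀ n : ℕ, (term R n).toLinPsh.IsIndBanach k

/-- The ideal of `R₀` consisting of the elements `d₀ y - d₁ y` with `y` in `R₁`. -/
def pi0Idl (R : SimplicialObject (CAlg H)) : Idl (term R 0) where
  sub P := LinearMap.range (app (R.δ (n := 0) 0) P - app (R.δ (n := 0) 1) P)
  map_mem f x hx := by
    obtain ⟨y, rfl⟩ := hx
    exact ⟨(term R 1).map f y, by simp [app_natural]⟩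
  mul_mem x y hy := by
    obtain ⟨z, rfl⟩ := hy
    refine ⟨(term R 1).mul (app (R.σ (n := 0) 0) _ x) z, ?_⟩
    have h0 : app (R.δ (n := 0) 0) _ (app (R.σ (n := 0) 0) _ x) = x := by
      rw [← app_comp]
      exact congrArg (fun a => app a _ x) (R.δ_comp_σ_self (n := 0) (i := 0))
    have h1 : app (R.δ (n := 0) 1) _ (app (R.σ (n := 0) 0) _ x) = x := by
      rw [← app_comp]
      exact congrArg (fun a => app a _ x) (R.δ_comp_σ_succ (n := 0) (i := 0))
    rw [LinearMap.sub_apply, app_mul, app_mul, h0, h1, LinearMap.sub_apply, map_sub]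
  mem_of_isDense i hi x hx := by
    obtain ⟨y, hy⟩ := hx
    obtain ⟨z, rfl⟩ := ((term R 1).bijective_of_isDense i hi).2 y
    refine ⟨z, ((term R 0).bijective_of_isDense i hi).1 ?_⟩
    rw [← hy]
    simp [app_natural]

/-- `π₀(R)`, the coequalizer of `d₀, d₁ : R₁ ⇉ R₀` (in the left heart). -/
def pi0 (R : SimplicialObject (CAlg H)) : CAlg H := (pi0Idl R).quot

/-- The projection `R ⟶ π₀(R)`, where `π₀(R)` is considered as a constant simplicial object. -/
def toPi0 (R : SimplicialObject (CAlg H)) :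
    R ⟶ (SimplicialObject.const (CAlg H)).obj (pi0 R) where
  app n := R.map (SimplexCategory.const (SimplexCategory.mk 0) n.unop 0).op ≫ (pi0Idl R).proj
  naturality {n m} θ := by
    refine hom_ext fun P x => ?_
    have key : ∀ j : Fin (n.unop.len + 1),
        app (pi0Idl R).proj P
          (app (R.map (SimplexCategory.const (SimplexCategory.mk 0) n.unop j).op) P x) =
        app (pi0Idl R).proj P
          (app (R.map (SimplexCategory.const (SimplexCategory.mk 0) n.unop 0).op) P x) := by
      intro j
      refine (Submodule.Quotient.eq _).2
        ⟨app (R.map (SimplexCategory.mkOfLe (n := n.unop.len) 0 j (Fin.zero_le j)).op) P x, ?_⟩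
      have h0 : (SimplexCategory.mkOfLe (n := n.unop.len) 0 j (Fin.zero_le j)).op ≫
          (SimplexCategory.δ (n := 0) 0).op =
          (SimplexCategory.const (SimplexCategory.mk 0) n.unop j).op := by
        rw [← op_comp]
        congr 1
        ext i
        fin_cases i
        rfl
      have h1 : (SimplexCategory.mkOfLe (n := n.unop.len) 0 j (Fin.zero_le j)).op ≫
          (SimplexCategory.δ (n := 0) 1).op =
          (SimplexCategory.const (SimplexCategory.mk 0) n.unop 0).op := by
        rw [← op_comp]
        congr 1
        ext i
        fin_cases i
        rfl
      rw [LinearMap.sub_apply, ← app_comp, ← app_comp, SimplicialObject.δ, SimplicialObject.δ,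
        ← h0, ← h1, R.map_comp, R.map_comp]
    have hθ : θ ≫ (SimplexCategory.const (SimplexCategory.mk 0) m.unop 0).op =
        (SimplexCategory.const (SimplexCategory.mk 0) n.unop (θ.unop.toOrderHom 0)).op := rfl
    have := key (θ.unop.toOrderHom 0)
    rw [← hθ, R.map_comp] at this
    exact this

/-- The map induced on `π₀` by a homomorphism. -/
def pi0Map {A B : SimplicialObject (CAlg H)} (f : A ⟶ B) : pi0 A ⟶ pi0 B :=
  have hf : ∀ P, (pi0Idl A).sub P ≤ ((pi0Idl B).sub P).comap (app (f.app _) P) := by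
    rintro P _ ⟨y, rfl⟩
    refine ⟨app (f.app _) P y, ?_⟩
    have h0 := SimplicialObject.δ_naturality f (n := 0) 0
    have h1 := SimplicialObject.δ_naturality f (n := 0) 1
    rw [LinearMap.sub_apply, LinearMap.sub_apply, map_sub, ← app_comp, ← app_comp, ← app_comp,
      ← app_comp, h0, h1]
  (⟨fun P => Submodule.mapQ _ _ (app (f.app _) P) (hf P),
    fun g x => by
      obtain ⟨x, rfl⟩ := Submodule.mkQ_surjective _ x
      exact congrArg ((pi0Idl B).sub _).mkQ (app_natural (f.app _) g x),
    fun x y => by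
      obtain ⟨x, rfl⟩ := Submodule.mkQ_surjective _ x
      obtain ⟨y, rfl⟩ := Submodule.mkQ_surjective _ y
      exact congrArg ((pi0Idl B).sub _).mkQ (app_mul (f.app _) x y),
    congrArg ((pi0Idl B).sub _).mkQ (app_one (f.app _))⟩ : Hom (pi0 A) (pi0 B))

/-! ### Derived mapping spaces -/

/-- Trivial fibrations: homomorphisms inducing trivial Kan fibrations
`Hom(P, R) ⟶ Hom(P, S)` for all projective `P`. -/
def IsTrivFib {R S : SimplicialObject (CAlg H)} (p : R ⟶ S) : Prop :=
  ∀ P : NMod H, P.IsProjective → ∀ n : ℕ,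
    HasLiftingProperty (SSet.boundary.{u} n).ι
      (((SimplicialObject.whiskering (CAlg H) (Type u)).obj (evalAt P)).map p : _ ⟶ _)

/-- Cofibrations: homomorphisms with the left lifting property against trivial fibrations of
simplicial commutative ind-Banach algebras. -/
def IsCofib (k : IndKind) {A B : SimplicialObject (CAlg H)} (i : A ⟶ B) : Prop :=
  ∀ (R S : SimplicialObject (CAlg H)), IsSimplicialIndBanach k R → IsSimplicialIndBanach k S →
    ∀ p : R ⟶ S, IsTrivFib p → HasLiftingProperty i p

/-- Cofibrant objects. -/
def IsCofibrant (k : IndKind) (A : SimplicialObject (CAlg H)) : Prop :=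
  ∀ (R S : SimplicialObject (CAlg H)), IsSimplicialIndBanach k R → IsSimplicialIndBanach k S →
    ∀ p : R ⟶ S, IsTrivFib p → ∀ f : A ⟶ S, ∃ g : A ⟶ R, g ≫ p = f

/-- A cofibrant replacement of the homomorphism `f : A ⟶ B`: a cofibration `map` between cofibrant
simplicial commutative ind-Banach algebras, with trivial fibrations to `A` and `B`. -/
structure CofRepl (k : IndKind) {A B : SimplicialObject (CAlg H)} (f : A ⟶ B) where
  src : SimplicialObject (CAlg H)
  tgt : SimplicialObject (CAlg H)
  src_ind : IsSimplicialIndBanach k src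
  tgt_ind : IsSimplicialIndBanach k tgt
  map : src ⟶ tgt
  toA : src ⟶ A
  toB : tgt ⟶ B
  comm : map ≫ toB = toA ≫ f
  cofibrant : IsCofibrant k src
  cofib : IsCofib k map
  toA_trivFib : IsTrivFib toA
  toB_trivFib : IsTrivFib toB

/-- The nilpotent ideals of `π₀(R)`, ordered by inclusion. -/
abbrev NilIdl (R : SimplicialObject (CAlg H)) : Type (u + 1) := {J : Idl (pi0 R) // J.IsNilp}

/-- The zero ideal. -/
def NilIdl.zero (R : SimplicialObject (CAlg H)) : NilIdl R := ⟨Idl.zero _, Idl.zero_isNilp _⟩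

/-- The pairs `(J, γ)` of a nilpotent ideal `J` of `π₀(R)` and a divided power structure `γ` on
`J`. -/
structure PDIdl (R : SimplicialObject (CAlg H)) where
  idl : NilIdl R
  pd : DividedPowers idl.1.pts

/-- There is a morphism `(J, γ) ⟶ (J', γ')` if `J ≤ J'` and `γ'` extends `γ`. -/
instance (R : SimplicialObject (CAlg H)) : Preorder (PDIdl R) where
  le J K := J.idl ≤ K.idl ∧ J.pd.IsDPMorphism K.pd (RingHom.id _)
  le_refl J := ⟨le_rfl, by rw [Ideal.map_id], fun _ _ => rfl⟩
  le_trans J K L h h' := ⟨h.1.trans h'.1, by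
      rw [Ideal.map_id]
      exact fun x hx => h'.1 _ (h.1 _ hx),
    fun a ha => (h'.2.dpow_comp a (h.1 _ ha)).trans (h.2.dpow_comp a ha)⟩

/-- The zero ideal with its divided power structure. -/
def PDIdl.zero (R : SimplicialObject (CAlg H)) : PDIdl R where
  idl := NilIdl.zero R
  pd := dividedPowersBot (pi0 R).Pts

/-- Forgetting the divided power structure. -/
def PDIdl.forget (R : SimplicialObject (CAlg H)) : PDIdl R ⥤ NilIdl R where
  obj J := J.idl
  map h := homOfLE h.le.1

/-- The quotients `π₀(R)/J`, as (constant) simplicial commutative algebras. -/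
def quotients (R : SimplicialObject (CAlg H)) : NilIdl R ⥤ SimplicialObject (CAlg H) where
  obj J := (SimplicialObject.const (CAlg H)).obj J.1.quot
  map h := (SimplicialObject.const (CAlg H)).map (Idl.trans (leOfHom h))
  map_id J := by
    refine NatTrans.ext (funext fun n => hom_ext fun P x => ?_)
    obtain ⟨x, rfl⟩ := Submodule.mkQ_surjective _ x
    rfl
  map_comp f g := by
    refine NatTrans.ext (funext fun n => hom_ext fun P x => ?_)
    obtain ⟨x, rfl⟩ := Submodule.mkQ_surjective _ x
    rfl

/-- The projections `R ⟶ π₀(R) ⟶ π₀(R)/J`. -/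
def toQuotients (R : SimplicialObject (CAlg H)) :
    (Functor.const (NilIdl R)).obj R ⟶ quotients R where
  app J := toPi0 R ≫ (SimplicialObject.const (CAlg H)).map J.1.proj
  naturality J K h := by
    refine NatTrans.ext (funext fun n => hom_ext fun P x => ?_)
    rfl

open SimplicialCategory

variable {k : IndKind} {A B : SimplicialObject (CAlg H)} {f : A ⟶ B}

/-- `Spec`: the functor of points `R ↦ Map(A, R)` with values in simplicial sets; it computes the
derived mapping spaces when `A` is cofibrant. -/
def spec (A : SimplicialObject (CAlg H)) : SimplicialObject (CAlg H) ⥤ SSet.{u + 1} :=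
  (sHomFunctor (SimplicialObject (CAlg H))).obj (op A)

/-- The map `Spec B ⟶ Spec A` induced by `A ⟶ B`. -/
def specMap (i : A ⟶ B) : spec B ⟶ spec A :=
  (sHomFunctor (SimplicialObject (CAlg H))).map i.op

variable (c : CofRepl k f) (R : SimplicialObject (CAlg H))

/-- For `X = Spec B ⟶ Y = Spec A`, the diagram `J ↦ X(π₀(R)/J) ×_{Y(π₀(R)/J)} Y(R)` of spaces.  The
fibre product is a homotopy fibre product since the simplicial set `Y(π₀(R)/J)` is discrete. -/
def fibreDiagram : NilIdl R ⥤ SSet.{u + 1} :=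
  Limits.pullback (Functor.whiskerLeft (quotients R) (specMap c.map))
    (Functor.whiskerRight (toQuotients R) (spec c.src) :
      (Functor.const (NilIdl R)).obj R ⋙ spec c.src ⟶ quotients R ⋙ spec c.src)

/-- The canonical maps `X(R) ⟶ X(π₀(R)/J) ×_{Y(π₀(R)/J)} Y(R)`. -/
def toFibreDiagram :
    (Functor.const (NilIdl R)).obj R ⋙ spec c.tgt ⟶ fibreDiagram c R :=
  Limits.pullback.lift
    (Functor.whiskerRight (toQuotients R) (spec c.tgt))
    (Functor.whiskerLeft ((Functor.const (NilIdl R)).obj R) (specMap c.map))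
    (by ext1; ext1 J; exact ((specMap c.map).naturality _))

/-- `Y_{X,dR}(R) = colim_J X(π₀(R)/J) ×_{Y(π₀(R)/J)} Y(R)`, over the nilpotent ideals of `π₀(R)`. -/
def formalCompletion : SSet.{u + 1} := Limits.colimit (fibreDiagram c R)

/-- The map `X(R) ⟶ Y_{X,dR}(R)`. -/
def toFormalCompletion : (spec c.tgt).obj R ⟶ formalCompletion c R :=
  (toFibreDiagram c R).app (NilIdl.zero R) ≫ Limits.colimit.ι (fibreDiagram c R) (NilIdl.zero R)

/-- `Y_{X,crys}(R) = colim_{(J,γ)} X(π₀(R)/J) ×_{Y(π₀(R)/J)} Y(R)`, over the nilpotent ideals of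
`π₀(R)` with divided power structures. -/
def pdCompletion : SSet.{u + 1} := Limits.colimit (PDIdl.forget R ⋙ fibreDiagram c R)

/-- The map `X(R) ⟶ Y_{X,crys}(R)`. -/
def toPDCompletion : (spec c.tgt).obj R ⟶ pdCompletion c R :=
  (toFibreDiagram c R).app (NilIdl.zero R) ≫
    Limits.colimit.ι (PDIdl.forget R ⋙ fibreDiagram c R) (PDIdl.zero R)

end CAlg

/-! ### Affinoid morphisms -/

section Gauss

variable (H : Type u) [NormedCommRing H]

/-- The Gauss norm of a polynomial: the maximum of the norms of its coefficients. -/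
def gaussNorm (d : ℕ) (p : MvPolynomial (Fin d) H) : ℝ :=
  (p.support.sup fun m => ‖MvPolynomial.coeff m p‖₊ : NNReal)

variable {H} {d : ℕ}

theorem norm_coeff_le_gaussNorm (p : MvPolynomial (Fin d) H) (m : Fin d →₀ ℕ) :
    ‖MvPolynomial.coeff m p‖ ≤ gaussNorm H d p := by
  by_cases hm : m ∈ p.support
  · exact NNReal.coe_le_coe.2 (Finset.le_sup (f := fun m => ‖MvPolynomial.coeff m p‖₊) hm)
  · rw [MvPolynomial.notMem_support_iff.1 hm, norm_zero]
    exact NNReal.coe_nonneg _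

theorem gaussNorm_le {p : MvPolynomial (Fin d) H} {r : ℝ} (hr : 0 ≤ r)
    (h : ∀ m, ‖MvPolynomial.coeff m p‖ ≤ r) : gaussNorm H d p ≤ r := by
  lift r to NNReal using hr
  exact NNReal.coe_le_coe.2 (Finset.sup_le fun m _ => NNReal.coe_le_coe.1 (h m))

theorem gaussNorm_nonneg (p : MvPolynomial (Fin d) H) : 0 ≤ gaussNorm H d p := NNReal.coe_nonneg _

theorem gaussNorm_C_le (h : H) : gaussNorm H d (MvPolynomial.C h) ≤ ‖h‖ := by
  refine gaussNorm_le (norm_nonneg h) fun m => ?_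
  rw [MvPolynomial.coeff_C]
  split_ifs
  · exact le_rfl
  · rw [norm_zero]
    exact norm_nonneg _

variable [IsUltrametricDist H]

theorem gaussNorm_add_le_max (p q : MvPolynomial (Fin d) H) :
    gaussNorm H d (p + q) ≤ max (gaussNorm H d p) (gaussNorm H d q) := by
  refine gaussNorm_le (le_max_of_le_left (gaussNorm_nonneg p)) fun m => ?_
  rw [MvPolynomial.coeff_add]
  exact (IsUltrametricDist.norm_add_le_max _ _).trans
    (max_le_max (norm_coeff_le_gaussNorm p m) (norm_coeff_le_gaussNorm q m))

theorem gaussNorm_mul_le (p q : MvPolynomial (Fin d) H) :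
    gaussNorm H d (p * q) ≤ gaussNorm H d p * gaussNorm H d q := by
  have h0 : 0 ≤ gaussNorm H d p * gaussNorm H d q :=
    mul_nonneg (gaussNorm_nonneg p) (gaussNorm_nonneg q)
  refine gaussNorm_le h0 fun m => ?_
  rw [MvPolynomial.coeff_mul]
  refine IsUltrametricDist.norm_sum_le_of_forall_le_of_nonneg h0 fun x _ => ?_
  exact (norm_mul_le _ _).trans (mul_le_mul (norm_coeff_le_gaussNorm _ _)
    (norm_coeff_le_gaussNorm _ _) (norm_nonneg _) (gaussNorm_nonneg p))

variable (H d)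

/-- The polynomial ring `H[X₁, …, X_d]` with the Gauss norm; its completion is the Tate algebra
`H⟨X₁, …, X_d⟩`. -/
def gauss : NMod H where
  carrier := MvPolynomial (Fin d) H
  grp := (({ toFun := gaussNorm H d
             map_zero' := le_antisymm (gaussNorm_le le_rfl fun m => by simp) (gaussNorm_nonneg _)
             add_le' := fun p q => (gaussNorm_add_le_max p q).trans
               (max_le_add_of_nonneg (gaussNorm_nonneg p) (gaussNorm_nonneg q))
             neg' := fun p => by
               simp [gaussNorm, MvPolynomial.support_neg] } :
      AddGroupSeminorm (MvPolynomial (Fin d) H))).toSeminormedAddCommGroup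
  mod := (inferInstance : Module H (MvPolynomial (Fin d) H))
  norm_smul_le := fun h p => by
    refine gaussNorm_le (mul_nonneg (norm_nonneg h) (gaussNorm_nonneg p)) fun m => ?_
    rw [MvPolynomial.coeff_smul, smul_eq_mul]
    exact (norm_mul_le _ _).trans
      (mul_le_mul_of_nonneg_left (norm_coeff_le_gaussNorm p m) (norm_nonneg h))
  norm_add_le_max := gaussNorm_add_le_max

/-- The multiplication of `H[X₁, …, X_d]`. -/
def gaussMul : tens (gauss H d) (gauss H d) ⟶ gauss H d :=
  tLift (P := gauss H d) (Q := gauss H d) (N := gauss H d)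
    (LinearMap.mul' H (MvPolynomial (Fin d) H)) 1 zero_le_one fun p q => by
      rw [one_mul]
      exact gaussNorm_mul_le (H := H) (d := d) p q

/-- The unit of `H[X₁, …, X_d]`. -/
def gaussUnit : unit H ⟶ gauss H d :=
  ofLin (P := unit H) (Q := gauss H d) (Algebra.linearMap H (MvPolynomial (Fin d) H)) 1 zero_le_one
    fun h => (gaussNorm_C_le (H := H) (d := d) h).trans (one_mul ‖h‖).ge

end Gauss

namespace CAlg

variable {H : Type u} [NormedCommRing H] [IsUltrametricDist H]

/-- The element `φ ∈ F(H⟨X₁, …, X_d⟩)`, i.e. the linear map `φ : H⟨X₁, …, X_d⟩ ⟶ F`, is a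
homomorphism of algebras. -/
def IsTateHom {F : CAlg H} {d : ℕ} (φ : F.obj (gauss H d)) : Prop :=
  F.map (gaussUnit H d) φ = F.one ∧ F.map (gaussMul H d) φ = F.mul φ φ

/-- The homomorphism `F⟨X₁, …, X_d⟩ ⟶ G` given by `g : F ⟶ G` and `φ : H⟨X₁, …, X_d⟩ ⟶ G` is
surjective (an epimorphism in the left heart).  Up to linear combinations, a map from a projective
`P` to `F⟨X₁, …, X_d⟩` is given by a map `x : M ⟶ F` and a map `v : P ⟶ M⟨X₁, …, X_d⟩`, where
`M⟨X₁, …, X_d⟩` is the completion of `M ⊗ H[X₁, …, X_d]`; its image in `G(P)` is the restriction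
along `v` of the extension `z` of `g(x) · φ` to `M⟨X₁, …, X_d⟩`. -/
def IsTateSurjective {F G : CAlg H} (g : F ⟶ G) {d : ℕ} (φ : G.obj (gauss H d)) : Prop :=
  ∀ P : NMod H, P.IsProjective → ∀ y : G.obj P,
    ∃ (M N : NMod H) (ι : tens M (gauss H d) ⟶ N) (x : F.obj M) (z : G.obj N) (v : P ⟶ N),
      N.IsBanach ∧ IsDense ι ∧ G.map ι z = G.mul (app g M x) φ ∧ G.map v z = y

/-- A module over a commutative algebra. -/
structure AMod (F : CAlg H) extends LinPsh H where
  act : ∀ {P Q : NMod H}, F.obj P →ₗ[H] obj Q →ₗ[H] obj (tens P Q)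
  act_natural : ∀ {P P' Q Q' : NMod H} (f : P ⟶ P') (g : Q ⟶ Q') (x : F.obj P') (y : obj Q'),
    map (tMap f g) (act x y) = act (F.map f x) (map g y)
  mul_act : ∀ {P Q S : NMod H} (x : F.obj P) (y : F.obj Q) (z : obj S),
    map (tAssoc P Q S) (act x (act y z)) = act (F.mul x y) z
  one_act : ∀ {P : NMod H} (x : obj P), map (tUnit P) (act F.one x) = x

/-- The normalized `(n+1)`-cycles of the simplicial module `R(P)`. -/
def cycles (R : SimplicialObject (CAlg H)) (n : ℕ) (P : NMod H) :
    Submodule H ((term R (n + 1)).obj P) :=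
  ⨅ i : Fin (n + 2), LinearMap.ker (app (R.δ (n := n) i) P)

/-- The total degeneracy `R₀ ⟶ Rₙ`. -/
def degen (R : SimplicialObject (CAlg H)) (n : ℕ) : term R 0 ⟶ term R n :=
  R.map (SimplexCategory.const (SimplexCategory.mk n) (SimplexCategory.mk 0) 0).op

/-- A homomorphism `π_{n+1}(R) ⟶ N` in the left heart, where `N` is a module over `F` and
`φ : π₀(R) ⟶ F`, which is linear over `φ`.  Here `π_{n+1}(R)` is the presheaf
`P ↦ π_{n+1}(R(P))` on projective modules, with its structure of a module over `π₀(R)`. -/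
@[ext]
structure PiHom (R : SimplicialObject (CAlg H)) (n : ℕ) {F : CAlg H} (φ : pi0 R ⟶ F)
    (N : AMod F) where
  app : ∀ P : NMod H, P.IsProjective → (cycles R n P →ₗ[H] N.obj P)
  boundary : ∀ (P : NMod H) (hP : P.IsProjective) (z : cycles R n P)
    (y : (term R (n + 2)).obj P),
    (∀ i : Fin (n + 2), CAlg.app (R.δ (n := n + 1) i.succ) P y = 0) →
      CAlg.app (R.δ (n := n + 1) 0) P y = z.1 → app P hP z = 0
  natural : ∀ (P Q : NMod H) (hP : P.IsProjective) (hQ : Q.IsProjective) (f : P ⟶ Q)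
    (w : cycles R n P) (z : cycles R n Q), w.1 = (term R (n + 1)).map f z.1 →
      app P hP w = N.map f (app Q hQ z)
  linear : ∀ (P Q : NMod H) (hQ : Q.IsProjective) (hPQ : (tens P Q).IsProjective),
    P.IsProjective → ∀ (a : (term R 0).obj P) (z : cycles R n Q) (w : cycles R n (tens P Q)),
      w.1 = (term R (n + 1)).mul (CAlg.app (degen R (n + 1)) P a) z.1 →
      app (tens P Q) hPQ w =
        N.act (CAlg.app φ P (CAlg.app (pi0Idl R).proj P a)) (app Q hQ z)

/-- The canonical map `π₀(B) ⊗_{π₀(A)} π_{n+1}(A) ⟶ π_{n+1}(B)` is an isomorphism: the module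
`π_{n+1}(B)` has the universal property of the base change of `π_{n+1}(A)`. -/
def IsBaseChange {A B : SimplicialObject (CAlg H)} (f : A ⟶ B) (n : ℕ) : Prop :=
  ∀ (N : AMod (pi0 B)) (h : PiHom A n (pi0Map f) N), ∃! g : PiHom B n (𝟙 (pi0 B)) N,
    ∀ (P : NMod H) (hP : P.IsProjective) (z : cycles A n P) (w : cycles B n P),
      w.1 = app (f.app _) P z.1 → g.app P hP w = h.app P hP z

/-- Affinoid morphisms: there is a surjection `π₀(A)⟨X₁, …, X_d⟩ ⟶ π₀(B)` of `π₀(A)`-algebras, and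
`π₀(B) ⊗_{π₀(A)} π_n(A) ⟶ π_n(B)` is an isomorphism for all `n` (for `n = 0` this is
automatic). -/
def IsAffinoid {A B : SimplicialObject (CAlg H)} (f : A ⟶ B) : Prop :=
  (∃ (d : ℕ) (φ : (pi0 B).obj (gauss H d)), IsTateHom φ ∧ IsTateSurjective (pi0Map f) φ) ∧
    ∀ n : ℕ, IsBaseChange f n

/-! ### Intrinsic lisse morphisms -/

/-- De Rham intrinsic lisse morphisms `X = Spec B ⟶ Y = Spec A`: affinoid morphisms such that
`π₀(X(R)) ⟶ π₀(Y_{X,dR}(R))` is surjective for all `R`.  The spaces are computed by a cofibrant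
replacement of `A ⟶ B`, and do not depend on its choice up to weak equivalence. -/
def IsDeRhamLisse (k : IndKind) {A B : SimplicialObject (CAlg H)} (f : A ⟶ B) : Prop :=
  IsAffinoid f ∧ ∀ (c : CofRepl k f) (R : SimplicialObject (CAlg H)),
    IsSimplicialIndBanach k R → Function.Surjective (SSet.mapπ₀ (toFormalCompletion c R))

/-- PD intrinsic lisse morphisms `X = Spec B ⟶ Y = Spec A`: affinoid morphisms such that
`π₀(X(R)) ⟶ π₀(Y_{X,crys}(R))` is surjective for all `R`. -/
def IsPDLisse (k : IndKind) {A B : SimplicialObject (CAlg H)} (f : A ⟶ B) : Prop :=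
  IsAffinoid f ∧ ∀ (c : CofRepl k f) (R : SimplicialObject (CAlg H)),
    IsSimplicialIndBanach k R → Function.Surjective (SSet.mapπ₀ (toPDCompletion c R))

end CAlg

end

open CategoryTheory NMod

namespace CAlg

variable {H : Type u} [NormedCommRing H] [IsUltrametricDist H]

theorem smul_ptMul (F : CAlg H) (a : H) (x y : F.obj (unit H)) :
    F.ptMul (a • x) y = a • F.ptMul x y := by simp [ptMul]

theorem ptMul_smul (F : CAlg H) (a : H) (x y : F.obj (unit H)) :
    F.ptMul x (a • y) = a • F.ptMul x y := by simp [ptMul]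

/-- The ring of global elements of a commutative algebra over `H ⊇ ℚ` is a `ℚ`-algebra. -/
@[reducible]
noncomputable def ratAlgebraPts [Algebra ℚ H] (F : CAlg H) : Algebra ℚ F.Pts :=
  letI : Module H F.Pts := inferInstanceAs (Module H (F.obj (unit H)))
  letI : Algebra H F.Pts := Algebra.ofModule F.smul_ptMul F.ptMul_smul
  ((algebraMap H F.Pts).comp (algebraMap ℚ H)).toAlgebra

variable [Algebra ℚ H] (R : SimplicialObject (CAlg H))

open Classical in
/-- Every nilpotent ideal carries a divided power structure. -/
theorem PDIdl.exists_idl_eq (J : NilIdl R) : ∃ K : PDIdl R, K.idl = J :=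
  letI := ratAlgebraPts (pi0 R)
  ⟨⟨J, DividedPowers.RatAlgebra.dividedPowers _⟩, rfl⟩

/-- Divided power structures are compatible with every inclusion of nilpotent ideals. -/
theorem PDIdl.le_of_idl_le {J K : PDIdl R} (h : J.idl ≤ K.idl) : J ≤ K := by
  let _ := ratAlgebraPts (pi0 R)
  have hpts : J.idl.1.pts ≤ K.idl.1.pts := fun x hx => h _ hx
  refine ⟨h, by rwa [Ideal.map_id], fun a ha => ?_⟩
  rw [RingHom.id_apply, RingHom.id_apply,
    DividedPowers.RatAlgebra.dpow_eq_inv_fact_smul _ K.pd (hpts ha),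
    DividedPowers.RatAlgebra.dpow_eq_inv_fact_smul _ J.pd ha]

instance : (PDIdl.forget R).Full where
  map_surjective h := ⟨homOfLE (PDIdl.le_of_idl_le R (leOfHom h)), Subsingleton.elim _ _⟩

instance : (PDIdl.forget R).Faithful where
  map_injective _ := Subsingleton.elim _ _

instance : (PDIdl.forget R).EssSurj where
  mem_essImage J := by
    obtain ⟨K, rfl⟩ := PDIdl.exists_idl_eq R J
    exact ⟨K, ⟨Iso.refl _⟩⟩

instance : (PDIdl.forget R).IsEquivalence where

variable {k : IndKind} {A B : SimplicialObject (CAlg H)} {f : A ⟶ B} (c : CofRepl k f)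

/-- Over `ℚ`, the crystalline and the de Rham completions agree. -/
noncomputable def formalCompletionIso : formalCompletion c R ≅ pdCompletion c R :=
  (Functor.Final.colimitIso (PDIdl.forget R) (fibreDiagram c R)).symm

theorem toFormalCompletion_comp_iso :
    toFormalCompletion c R ≫ (formalCompletionIso R c).hom = toPDCompletion c R := by
  have h := Functor.Final.ι_colimitIso_inv (PDIdl.forget R) (fibreDiagram c R) (PDIdl.zero R)
  exact (Category.assoc _ _ _).trans (congrArg (fun t => (toFibreDiagram c R).app _ ≫ t) h)

/-- An isomorphism of simplicial sets is surjective on connected components. -/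
theorem mapPi0_iso_surjective {X Y : SSet.{u}} (e : X ≅ Y) :
    Function.Surjective (SSet.mapπ₀ e.hom) := fun y =>
  ⟨SSet.mapπ₀ e.inv y, by rw [← SSet.mapπ₀_comp_apply, e.inv_hom_id, SSet.mapπ₀_id_apply]⟩

end CAlg

theorem mainTheorem11 {H : Type u} [NormedCommRing H] [IsUltrametricDist H] [CompleteSpace H]
    [Algebra ℚ H] (k : IndKind) {A B : SimplicialObject (CAlg H)}
    (hA : CAlg.IsSimplicialIndBanach k A) (hB : CAlg.IsSimplicialIndBanach k B) (f : A ⟶ B)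
    (hf : CAlg.IsDeRhamLisse k f) : CAlg.IsPDLisse k f := by
  refine ⟨hf.1, fun c R hR y => ?_⟩
  obtain ⟨z, rfl⟩ := CAlg.mapPi0_iso_surjective (CAlg.formalCompletionIso R c) y
  obtain ⟨x, rfl⟩ := hf.2 c R hR z
  exact ⟨x, by rw [← CAlg.toFormalCompletion_comp_iso, SSet.mapπ₀_comp_apply]⟩
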